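/- Let $k \ge 0$ and let $a_1,\ldots,a_k$ be non-negative integers, $n = a_1+\cdots+a_k$, and let $S \subseteq \{1,\ldots,k\}$. Partition $\{1,\ldots,n\}$ into consecutive blocks $A_1,\ldots,A_k$ with $|A_i| = a_i$; call $A_i$ descending if $i \in S$ and ascending if $i \notin S$. An $(A,S)$-derangement is a permutation $\pi \in S_n$ without fixed points whose values $\pi(x)$ strictly decrease as $x$ runs in increasing order through each descending block and strictly increase as $x$ runs in increasing order through each ascending block. Call a cycle of $\pi \in S_n$ (fixed points being cycles of length $1$) small if all its elements lie in a single block. Put $c_S(\pi) = 0$ if $\pi$ has a small cycle of odd length or a small cycle in an ascending block, and otherwise $c_S(\pi) = 2^m$, where $m$ is the number of small cycles of $\pi$. Then the number of $(A,S)$-derangements is equal to $$\frac{1}{a_1!\cdots a_k!} \sum_{\pi \in S_n} c_S(\pi).$$ -/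

import Mathlib

namespace BlockDerangement

/-- The `i`-th of the consecutive blocks of lengths `a 0, a 1, …, a (k - 1)` into which the
`∑ j, a j` points are cut: it starts after the first `i` blocks and has `a i` points. -/
def block {k : ℕ} (a : Fin k → ℕ) (i : Fin k) : Finset (Fin (∑ j, a j)) :=
  {x | ∑ j ∈ Finset.Iio i, a j ≤ (x : ℕ) ∧ (x : ℕ) < ∑ j ∈ Finset.Iio i, a j + a i}

/-- `(A, S)`-permutations: the values descend in the blocks indexed by `S` and ascend in all
other blocks. -/
def IsASPerm {k : ℕ} (a : Fin k → ℕ) (S : Finset (Fin k))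
    (π : Equiv.Perm (Fin (∑ j, a j))) : Prop :=
  (∀ i ∈ S, StrictAntiOn π (block a i : Set (Fin (∑ j, a j)))) ∧
    ∀ i ∉ S, StrictMonoOn π (block a i : Set (Fin (∑ j, a j)))

/-- `(A, S)`-derangements: `(A, S)`-permutations without fixed points. -/
def asDerangements {k : ℕ} (a : Fin k → ℕ) (S : Finset (Fin k)) :
    Set (Equiv.Perm (Fin (∑ j, a j))) :=
  {π | IsASPerm a S π ∧ ∀ x, π x ≠ x}

/-- The cycles of a permutation, each given by the set of its points; a fixed point counts as a
cycle of length one. The length of a cycle is the cardinality of this set. -/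
def cycles {n : ℕ} (π : Equiv.Perm (Fin n)) : Finset (Finset (Fin n)) :=
  Finset.univ.image fun x => Finset.univ.filter fun y => π.SameCycle x y

/-- The small cycles: those that lie entirely within one block. -/
def smallCycles {k : ℕ} (a : Fin k → ℕ) (π : Equiv.Perm (Fin (∑ j, a j))) :
    Finset (Finset (Fin (∑ j, a j))) :=
  {C ∈ cycles π | ∃ i, C ⊆ block a i}

/-- `c_S(π)`: zero if some small cycle has odd length or lies in an ascending block, and
`2 ^ m` otherwise, where `m` is the number of small cycles. -/
def weight {k : ℕ} (a : Fin k → ℕ) (S : Finset (Fin k))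
    (π : Equiv.Perm (Fin (∑ j, a j))) : ℕ :=
  if (∃ C ∈ smallCycles a π, Odd C.card) ∨ (∃ C ∈ smallCycles a π, ∃ i ∉ S, C ⊆ block a i)
  then 0 else 2 ^ (smallCycles a π).card

end BlockDerangement

/-! Both sides equal the alternating sum of (-1)^|u| N(a - u), where N(c) is the multinomial
coefficient of c and u runs over the vectors with u_i ≤ a_i for all i and u_i ≤ 1 on ascending
blocks.

Weights: c_S(π) is the product of 1 + ε(C) over the small cycles C, with ε(C) = -1 in an ascending
block and (-1)^|C| in a descending one. Expanding gives a sum over unions U of small cycles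
(`sum_powerset_small_eq`). For fixed U, π runs over the permutations that preserve each U ∩ A_i, and
the product of the ε(C) is (-1)^|U| times the sign of π on the ascending part of U. A transposition
cancels everything unless U meets each ascending block in at most one point (`sum_prod_cycleSign`).
Otherwise (n - |U|)! ∏ u_i! permutations remain, where u_i = |U ∩ A_i|, and each u comes from ∏
C(a_i, u_i) sets U.

Derangements: an (A,S)-permutation is determined by the word of blocks of π⁻¹(x), placed as bottom
row under the word of blocks of x. A fixed point in block i becomes a column (i, i) whose two
entries have matching ranks. Deleting it maps the arrays with a fixed point in block i bijectively
to the arrays with one i fewer in each row: all of them if i is ascending, those without fixed point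
in block i if i is descending (`ncard_hasFix`). Fixed points in other blocks are unaffected, so the
blocks can be treated one at a time; the recursion in a_i stops after one step for ascending blocks
and runs down to 0 for descending ones. -/

namespace BlockDerangement

open Finset Equiv

/-! ### Cycles, including fixed points, and signs. -/

section Orbits

variable {α ι : Type*} [Fintype α] [DecidableEq α]

/-- The cycles of a permutation of a finite type, including the fixed points. -/
def orbitFinsets (π : Perm α) : Finset (Finset α) :=
  univ.image fun x => univ.filter fun y => π.SameCycle x y

theorem mem_orbitFinsets {π : Perm α} {C : Finset α} :
    C ∈ orbitFinsets π ↔ ∃ x, (univ.filter fun y => π.SameCycle x y) = C := by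
  simp [orbitFinsets]

theorem orbit_eq_of_mem {π : Perm α} {C : Finset α} (hC : C ∈ orbitFinsets π) {x : α}
    (hx : x ∈ C) : C = univ.filter fun y => π.SameCycle x y := by
  obtain ⟨z, rfl⟩ := mem_orbitFinsets.1 hC
  have hzx : π.SameCycle z x := by simpa using hx
  ext y
  simp only [mem_filter, mem_univ, true_and]
  exact ⟨fun h => hzx.symm.trans h, fun h => hzx.trans h⟩

theorem orbit_mem (π : Perm α) (x : α) :
    (univ.filter fun y => π.SameCycle x y) ∈ orbitFinsets π :=
  mem_orbitFinsets.2 ⟨x, rfl⟩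

theorem exists_mem_of_mem_orbitFinsets {π : Perm α} {C : Finset α} (hC : C ∈ orbitFinsets π) :
    ∃ x, x ∈ C := by
  obtain ⟨z, rfl⟩ := mem_orbitFinsets.1 hC
  exact ⟨z, by simp [Perm.SameCycle.refl]⟩

theorem apply_mem_of_mem_orbit {π : Perm α} {C : Finset α} (hC : C ∈ orbitFinsets π) (x : α) :
    π x ∈ C ↔ x ∈ C := by
  obtain ⟨z, rfl⟩ := mem_orbitFinsets.1 hC
  simp

omit [DecidableEq α] in
theorem apply_eq_of_sameCycle {γ : Type*} {q : α → γ} {π : Perm α} (h : q ∘ π = q) {x y : α}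
    (hxy : π.SameCycle x y) : q y = q x := by
  obtain ⟨n, hn⟩ := hxy.exists_nat_pow_eq
  have : ∀ m : ℕ, q ((π ^ m) x) = q x := by
    intro m
    induction m with
    | zero => rfl
    | succ m ih => rw [pow_succ', Perm.mul_apply, ← ih]; exact congrFun h _
  rw [← hn, this]

/-- A cycle of length l has sign (-1)^(l - 1) = -(-1)^l. Fixed points contribute 1, so including
them is harmless. -/
theorem sign_eq_prod_orbitFinsets (π : Perm α) :
    (Perm.sign π : ℤ) = ∏ C ∈ orbitFinsets π, -(-1 : ℤ) ^ #C := by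
  have h1 : (Perm.sign π : ℤ) = ∏ c ∈ π.cycleFactorsFinset, -(-1 : ℤ) ^ #c.support := by
    rw [Perm.sign_of_cycleType', Perm.cycleType_def, Multiset.map_map]
    change ((∏ c ∈ π.cycleFactorsFinset, -(-1 : ℤˣ) ^ #c.support : ℤˣ) : ℤ) = _
    push_cast
    rfl
  have hinj : Set.InjOn (fun c : Perm α => c.support) (π.cycleFactorsFinset : Set (Perm α)) := by
    intro c hc d hd hcd
    obtain ⟨x, hx⟩ := (Perm.mem_cycleFactorsFinset_iff.1 hc).1.nonempty_support
    have hx' : x ∈ d.support := by simpa [← hcd] using hx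
    rw [Perm.cycle_is_cycleOf hx hc, Perm.cycle_is_cycleOf hx' hd]
  have horb : ∀ x ∈ π.support, (π.cycleOf x).support = univ.filter fun y => π.SameCycle x y := by
    intro x hx
    ext y
    rw [Perm.mem_support_cycleOf_iff' (Perm.mem_support.1 hx)]
    simp
  rw [h1, ← prod_image (f := fun C : Finset α => -(-1 : ℤ) ^ #C) hinj]
  apply prod_subset
  · intro C hC
    obtain ⟨c, hc, rfl⟩ := mem_image.1 hC
    obtain ⟨x, hx⟩ := (Perm.mem_cycleFactorsFinset_iff.1 hc).1.nonempty_support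
    rw [Perm.cycle_is_cycleOf hx hc,
      horb x (Perm.mem_cycleFactorsFinset_support_le hc hx)]
    exact orbit_mem π x
  · intro C hC hC'
    obtain ⟨x, rfl⟩ := mem_orbitFinsets.1 hC
    by_cases hx : x ∈ π.support
    · refine absurd (mem_image.2 ⟨π.cycleOf x, ?_, horb x hx⟩) hC'
      exact Perm.cycleOf_mem_cycleFactorsFinset_iff.2 hx
    · have hfix : Function.IsFixedPt π x := Perm.notMem_support.1 hx
      have : (univ.filter fun y => π.SameCycle x y) = {x} := by
        ext y
        simp only [mem_filter, mem_univ, true_and, mem_singleton]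
        exact ⟨fun h => (h.eq_of_left hfix).symm, fun h => h ▸ Perm.SameCycle.refl _ _⟩
      simp [this]

theorem sign_subtypePerm_eq_prod_orbitFinsets (π : Perm α) (V : Finset α)
    (h : ∀ x, π x ∈ V ↔ x ∈ V) :
    (Perm.sign (π.subtypePerm h) : ℤ) =
      ∏ C ∈ orbitFinsets π with C ⊆ V, -(-1 : ℤ) ^ #C := by
  rw [sign_eq_prod_orbitFinsets]
  have hsame : ∀ x y, π.SameCycle x y → (x ∈ V ↔ y ∈ V) := fun x y hxy =>
    (apply_eq_of_sameCycle (q := (· ∈ V)) (funext fun x => propext (h x)) hxy).symm.to_iff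
  have horb : ∀ x : {x // x ∈ V},
      (univ.filter fun y => (π.subtypePerm h).SameCycle x y).map (Function.Embedding.subtype _) =
        univ.filter fun y => π.SameCycle x y := by
    intro x
    ext y
    simp only [mem_map, mem_filter, mem_univ, true_and, Perm.sameCycle_subtypePerm,
      Function.Embedding.subtype_apply, Subtype.exists, exists_and_left, exists_prop,
      exists_eq_right_right]
    exact ⟨fun h => h.1, fun h => ⟨h, (hsame _ _ h).1 x.2⟩⟩
  refine prod_bij (fun C _ => C.map (Function.Embedding.subtype _)) ?_ ?_ ?_ ?_
  · intro C hC
    obtain ⟨x, rfl⟩ := mem_orbitFinsets.1 hC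
    refine mem_filter.2 ⟨?_, ?_⟩
    · rw [horb]
      exact orbit_mem _ _
    · intro y hy
      obtain ⟨z, -, rfl⟩ := mem_map.1 hy
      exact z.2
  · intro C _ D _ hCD
    exact map_injective _ hCD
  · intro C hC
    obtain ⟨hC, hCV⟩ := mem_filter.1 hC
    obtain ⟨x, hx⟩ := exists_mem_of_mem_orbitFinsets hC
    refine ⟨_, orbit_mem _ ⟨x, hCV hx⟩, ?_⟩
    rw [horb, ← orbit_eq_of_mem hC hx]
  · intro C _
    simp

end Orbits

/-! ### Expansion of the weights over unions of small cycles. -/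

section Expansion

variable {α ι : Type*} [Fintype α] [DecidableEq α] [DecidableEq ι]

/-- The label of a point: its block if the point belongs to `U`, and `none` otherwise. -/
def label (b : α → ι) (U : Finset α) (x : α) : Option ι := if x ∈ U then some (b x) else none

omit [Fintype α] [DecidableEq ι] in
theorem label_eq_some {b : α → ι} {U : Finset α} {x : α} {i : ι} :
    label b U x = some i ↔ x ∈ U ∧ b x = i := by
  unfold label; split_ifs <;> simp_all

omit [Fintype α] [DecidableEq ι] in
theorem label_eq_none {b : α → ι} {U : Finset α} {x : α} :
    label b U x = none ↔ x ∉ U := by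
  unfold label; split_ifs <;> simp_all

omit [Fintype α] [DecidableEq ι] in
theorem mem_iff_of_label_eq {b : α → ι} {U : Finset α} {x y : α}
    (h : label b U y = label b U x) : y ∈ U ↔ x ∈ U := by
  rw [← not_iff_not, ← label_eq_none (b := b), ← label_eq_none (b := b), h]

omit [Fintype α] [DecidableEq ι] in
theorem block_eq_of_label_eq {b : α → ι} {U : Finset α} {x y : α}
    (h : label b U y = label b U x) (hx : x ∈ U) : b y = b x :=
  (label_eq_some.1 (h.trans (label_eq_some.2 ⟨hx, rfl⟩))).2

/-- Sets of small cycles correspond to their unions U. Such unions are exactly the U whose label is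
π-invariant: invariance says that π preserves U and, on U, the block. -/
theorem sum_powerset_small_eq (b : α → ι) (π : Perm α) (ε : Finset α → ℤ)
    [DecidablePred fun C : Finset α => ∃ i, ∀ x ∈ C, b x = i] :
    ∏ C ∈ orbitFinsets π with ∃ i, ∀ x ∈ C, b x = i, (1 + ε C) =
      ∑ U : Finset α with label b U ∘ π = label b U,
        ∏ C ∈ orbitFinsets π with C ⊆ U, ε C := by
  rw [prod_one_add]
  have hleft : ∀ T ⊆ orbitFinsets π, (orbitFinsets π).filter (· ⊆ T.biUnion id) = T := by
    intro T hT
    ext C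
    simp only [mem_filter]
    constructor
    · rintro ⟨hC, hCT⟩
      obtain ⟨x, hx⟩ := exists_mem_of_mem_orbitFinsets hC
      obtain ⟨D, hD, hxD⟩ := mem_biUnion.1 (hCT hx)
      rw [orbit_eq_of_mem hC hx, ← orbit_eq_of_mem (hT hD) hxD]
      exact hD
    · intro hC
      exact ⟨hT hC, fun x hx => mem_biUnion.2 ⟨C, hC, hx⟩⟩
  refine sum_nbij' (fun T => T.biUnion id) (fun U => (orbitFinsets π).filter (· ⊆ U))
    ?_ ?_ ?_ ?_ ?_
  · intro T hT
    have hT' := mem_powerset.1 hT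
    refine mem_filter.2 ⟨mem_univ _, funext fun x => ?_⟩
    have hiff : π x ∈ T.biUnion id ↔ x ∈ T.biUnion id := by
      simp only [mem_biUnion, id]
      exact exists_congr fun C => and_congr_right fun hC =>
        apply_mem_of_mem_orbit (mem_filter.1 (hT' hC)).1 x
    by_cases hx : x ∈ T.biUnion id
    · obtain ⟨C, hC, hxC⟩ := mem_biUnion.1 hx
      obtain ⟨hCo, i, hi⟩ := mem_filter.1 (hT' hC)
      have h1 := hi x hxC
      have h2 := hi (π x) ((apply_mem_of_mem_orbit hCo x).2 hxC)
      simp only [Function.comp, label, if_pos hx, if_pos (hiff.2 hx), h1, h2]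
    · simp only [Function.comp, label, if_neg hx, if_neg (mt hiff.1 hx)]
  · intro U hU
    have hU := (mem_filter.1 hU).2
    refine mem_powerset.2 fun C hC => ?_
    obtain ⟨hC, hCU⟩ := mem_filter.1 hC
    obtain ⟨x, hx⟩ := exists_mem_of_mem_orbitFinsets hC
    refine mem_filter.2 ⟨hC, b x, fun y hy => ?_⟩
    rw [orbit_eq_of_mem hC hx] at hy
    exact block_eq_of_label_eq (apply_eq_of_sameCycle hU (mem_filter.1 hy).2) (hCU hx)
  · intro T hT
    exact hleft T ((mem_powerset.1 hT).trans (filter_subset _ _))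
  · intro U hU
    have hU := (mem_filter.1 hU).2
    ext x
    simp only [mem_biUnion, mem_filter, id]
    constructor
    · rintro ⟨C, ⟨-, hCU⟩, hx⟩
      exact hCU hx
    · intro hx
      refine ⟨_, ⟨orbit_mem π x, fun y hy => ?_⟩, by simp [Perm.SameCycle.refl]⟩
      exact (mem_iff_of_label_eq (apply_eq_of_sameCycle hU (mem_filter.1 hy).2)).2 hx
  · intro T hT
    rw [hleft T ((mem_powerset.1 hT).trans (filter_subset _ _))]

omit [DecidableEq ι] in
theorem prod_orbits_subset_neg_one_pow (b : α → ι) (π : Perm α) (U : Finset α)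
    (hU : label b U ∘ π = label b U) :
    ∏ C ∈ orbitFinsets π with C ⊆ U, (-1 : ℤ) ^ #C = (-1) ^ #U := by
  rw [prod_pow_eq_pow_sum]
  congr 1
  have hcard := card_biUnion (s := (orbitFinsets π).filter (· ⊆ U)) (t := id) ?_
  · refine hcard.symm.trans ?_
    congr 1
    ext x
    simp only [mem_biUnion, mem_filter, id]
    constructor
    · rintro ⟨C, ⟨-, hCU⟩, hx⟩
      exact hCU hx
    · intro hx
      refine ⟨_, ⟨orbit_mem π x, fun y hy => ?_⟩, by simp [Perm.SameCycle.refl]⟩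
      exact (mem_iff_of_label_eq (apply_eq_of_sameCycle hU (mem_filter.1 hy).2)).2 hx
  · intro C hC D hD hCD
    rw [Function.onFun, id, id, disjoint_left]
    intro x hx hx'
    exact hCD ((orbit_eq_of_mem (mem_filter.1 hC).1 hx).trans
      (orbit_eq_of_mem (mem_filter.1 hD).1 hx').symm)

/-- The sign attached to a small cycle: `-1` in an ascending block, and `(-1) ^ length` in a
descending block. -/
def cycleSign (b : α → ι) (S : Finset ι) (C : Finset α) : ℤ :=
  if ∀ x ∈ C, b x ∉ S then -1 else (-1) ^ #C

/-- Writing -1 = (-1)^|C| · (-(-1)^|C|) for ascending cycles splits off (-1)^|U| and leaves the sign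
of π on the ascending part of U. -/
theorem prod_cycleSign (b : α → ι) (S : Finset ι) (π : Perm α) (U : Finset α)
    (hU : label b U ∘ π = label b U) :
    ∏ C ∈ orbitFinsets π with C ⊆ U, cycleSign b S C =
      (-1) ^ #U * ∏ C ∈ orbitFinsets π with C ⊆ U.filter fun x => b x ∉ S, -(-1 : ℤ) ^ #C := by
  have h1 : ∀ C : Finset α, cycleSign b S C =
      (-1) ^ #C * if ∀ x ∈ C, b x ∉ S then -(-1 : ℤ) ^ #C else 1 := by
    intro C
    unfold cycleSign
    split_ifs
    · rw [mul_neg, ← mul_pow]; simp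
    · simp
  simp_rw [h1]
  rw [prod_mul_distrib, prod_orbits_subset_neg_one_pow b π U hU, ← prod_filter, filter_filter]
  congr 2
  ext C
  simp only [mem_filter, subset_iff, and_congr_right_iff]
  intro _
  exact ⟨fun h x hx => ⟨h.1 hx, h.2 x hx⟩, fun h => ⟨fun x hx => (h hx).1, fun x hx => (h hx).2⟩⟩

theorem sum_prod_cycleSign [Fintype ι] (b : α → ι) (S : Finset ι) (U : Finset α) :
    ∑ π ∈ univ.filter fun π : Perm α => label b U ∘ π = label b U,
        ∏ C ∈ orbitFinsets π with C ⊆ U, cycleSign b S C =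
      (-1) ^ #U * if ∀ i ∉ S, #{x ∈ U | b x = i} ≤ 1 then
        (((Fintype.card α - #U).factorial * ∏ i, (#{x ∈ U | b x = i}).factorial : ℕ) : ℤ)
        else 0 := by
  rw [sum_congr rfl fun π hπ => prod_cycleSign b S π U (mem_filter.1 hπ).2, ← mul_sum]
  congr 1
  have hsame : ∀ {π : Perm α}, label b U ∘ π = label b U → ∀ x y, π.SameCycle x y →
      label b U y = label b U x := fun h x y => apply_eq_of_sameCycle h
  split_ifs with h
  · have hone : ∀ π : Perm α, label b U ∘ π = label b U →
        ∏ C ∈ orbitFinsets π with C ⊆ U.filter fun x => b x ∉ S, -(-1 : ℤ) ^ #C = 1 := by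
      intro π hπ
      refine prod_eq_one fun C hC => ?_
      obtain ⟨hC, hCU⟩ := mem_filter.1 hC
      obtain ⟨x, hx⟩ := exists_mem_of_mem_orbitFinsets hC
      obtain ⟨hxU, hxS⟩ := mem_filter.1 (hCU hx)
      have : C = {x} := by
        refine eq_singleton_iff_unique_mem.2 ⟨hx, fun y hy => ?_⟩
        have hyU := (mem_filter.1 (hCU hy)).1
        rw [orbit_eq_of_mem hC hx] at hy
        have := block_eq_of_label_eq (hsame hπ _ _ (mem_filter.1 hy).2) hxU
        exact card_le_one.1 (h (b x) hxS) y (by simp [hyU, this]) x (by simp [hxU])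
      simp [this]
    rw [sum_congr rfl fun π hπ => hone π (mem_filter.1 hπ).2, sum_const, nsmul_one]
    congr 1
    -- Label-preserving permutations permute each label class separately; the class `none` is the
    -- complement of U.
    rw [← Fintype.card_subtype, DomMulAct.stabilizer_card, Fintype.prod_option]
    congr 2
    · rw [Fintype.card_subtype, ← card_compl]
      congr 1
      ext x
      simp [label_eq_none]
    · funext i
      rw [Fintype.card_subtype]
      congr 2
      ext x
      simp [label_eq_some]
  · push Not at h
    obtain ⟨i, hiS, hi⟩ := h
    obtain ⟨x, hx, y, hy, hxy⟩ := one_lt_card.1 hi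
    obtain ⟨hxU, hxi⟩ := mem_filter.1 hx
    obtain ⟨hyU, hyi⟩ := mem_filter.1 hy
    -- Two points of U in one ascending block: multiplying by their transposition preserves labels
    -- and reverses the sign on V, so the sum equals its own negative.
    have hlab : ∀ z, label b U (swap x y z) = label b U z := by
      have h : label b U x = label b U y := by
        rw [label_eq_some.2 ⟨hxU, hxi⟩, label_eq_some.2 ⟨hyU, hyi⟩]
      intro z
      rw [swap_apply_def]
      split_ifs with h1 h2
      · rw [h1, h]
      · rw [h2, h]
      · rfl
    set V := U.filter fun x => b x ∉ S with hV
    have hinv : ∀ π : Perm α, label b U ∘ π = label b U → ∀ x, π x ∈ V ↔ x ∈ V := by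
      intro π hπ x
      have hl : label b U (π x) = label b U x := congrFun hπ x
      rw [hV, mem_filter, mem_filter, mem_iff_of_label_eq hl]
      exact and_congr_right fun hx => by rw [block_eq_of_label_eq hl hx]
    have hxV : x ∈ V := by simp [hV, hxU, hxi, hiS]
    have hyV : y ∈ V := by simp [hV, hyU, hyi, hiS]
    have hswap : ∀ π : Perm α, label b U ∘ (π * swap x y) = label b U ↔
        label b U ∘ π = label b U := by
      intro π
      constructor
      · intro h
        funext z
        have := congrFun h (swap x y z)
        simpa [hlab] using this
      · intro h
        funext z
        have := congrFun h (swap x y z)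
        simpa [hlab] using this
    have hneg : ∀ π : Perm α, label b U ∘ π = label b U →
        ∏ C ∈ orbitFinsets (π * swap x y) with C ⊆ V, -(-1 : ℤ) ^ #C =
          - ∏ C ∈ orbitFinsets π with C ⊆ V, -(-1 : ℤ) ^ #C := by
      intro π hπ
      have h2 := hinv _ ((hswap π).2 hπ)
      rw [← sign_subtypePerm_eq_prod_orbitFinsets π V (hinv π hπ),
        ← sign_subtypePerm_eq_prod_orbitFinsets _ V h2]
      have : (π * swap x y).subtypePerm h2 =
          π.subtypePerm (hinv π hπ) * swap ⟨x, hxV⟩ ⟨y, hyV⟩ := by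
        ext z
        simp only [Perm.subtypePerm_apply, Perm.mul_apply, swap_apply_def, Subtype.ext_iff]
        split_ifs <;> rfl
      rw [this, Perm.sign_mul, Perm.sign_swap (by simpa [Subtype.ext_iff] using hxy)]
      simp
    have hsum : ∑ π ∈ univ.filter fun π : Perm α => label b U ∘ π = label b U,
          ∏ C ∈ orbitFinsets π with C ⊆ V, -(-1 : ℤ) ^ #C =
        ∑ π ∈ univ.filter fun π : Perm α => label b U ∘ π = label b U,
          ∏ C ∈ orbitFinsets (π * swap x y) with C ⊆ V, -(-1 : ℤ) ^ #C := by
      symm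
      refine sum_bij' (fun π _ => π * swap x y) (fun π _ => π * swap x y) ?_ ?_ ?_ ?_ ?_
      · exact fun π hπ => mem_filter.2 ⟨mem_univ _, (hswap π).2 (mem_filter.1 hπ).2⟩
      · exact fun π hπ => mem_filter.2 ⟨mem_univ _, (hswap π).2 (mem_filter.1 hπ).2⟩
      · intro π _; simp [mul_assoc]
      · intro π _; simp [mul_assoc]
      · intro π _; rfl
    rw [sum_congr rfl fun π hπ => hneg π (mem_filter.1 hπ).2, sum_neg_distrib] at hsum
    linarith

/-- A set U amounts to an independent choice of its trace on each block. -/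
theorem sum_card_fibers [Fintype ι] (b : α → ι) (G : (ι → ℕ) → ℤ) :
    ∑ U : Finset α, G (fun i => #{x ∈ U | b x = i}) =
      ∑ u ∈ Fintype.piFinset fun i => range (#{x | b x = i} + 1),
        ((∏ i, (#{x | b x = i}).choose (u i) : ℕ) : ℤ) * G u := by
  have hmaps : ∀ U ∈ (univ : Finset (Finset α)), (fun i => #{x ∈ U | b x = i}) ∈
      Fintype.piFinset fun i => range (#{x | b x = i} + 1) := by
    intro U _
    rw [Fintype.mem_piFinset]
    intro i
    rw [mem_range, Nat.lt_succ_iff]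
    exact card_le_card (filter_subset_filter _ (subset_univ _))
  rw [← sum_fiberwise_of_maps_to hmaps]
  refine sum_congr rfl fun u _ => ?_
  rw [sum_congr rfl fun U hU => congrArg G (mem_filter.1 hU).2, sum_const, nsmul_eq_mul]
  congr 2
  have : ∏ i, (#{x | b x = i}).choose (u i) =
      #(Fintype.piFinset fun i => powersetCard (u i) (univ.filter fun x => b x = i)) := by
    simp [Fintype.card_piFinset]
  rw [this]
  refine card_nbij' (fun U i => U.filter fun x => b x = i)
    (fun V => univ.filter fun x => x ∈ V (b x)) ?_ ?_ ?_ ?_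
  · intro U hU
    have hU := (mem_filter.1 hU).2
    simp only [mem_coe, Fintype.mem_piFinset, mem_powersetCard]
    exact fun i => ⟨filter_subset_filter _ (subset_univ _), congrFun hU i⟩
  · intro V hV
    simp only [mem_coe, Fintype.mem_piFinset, mem_powersetCard] at hV
    refine mem_filter.2 ⟨mem_univ _, funext fun i => ?_⟩
    rw [← (hV i).2]
    congr 1
    ext x
    simp only [mem_filter, mem_univ, true_and]
    constructor
    · rintro ⟨h, rfl⟩
      exact h
    · intro h
      have := (mem_filter.1 ((hV i).1 h)).2
      exact ⟨this.symm ▸ h, this⟩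
  · intro U _
    ext x
    simp
  · intro V hV
    simp only [mem_coe, Fintype.mem_piFinset, mem_powersetCard] at hV
    funext i
    ext x
    simp only [mem_filter, mem_univ, true_and]
    constructor
    · rintro ⟨h, rfl⟩
      exact h
    · intro h
      have := (mem_filter.1 ((hV i).1 h)).2
      exact ⟨this.symm ▸ h, this⟩

theorem sum_prod_one_add_cycleSign [Fintype ι] (b : α → ι) (S : Finset ι)
    [DecidablePred fun C : Finset α => ∃ i, ∀ x ∈ C, b x = i] :
    ∑ π : Perm α, ∏ C ∈ orbitFinsets π with ∃ i, ∀ x ∈ C, b x = i, (1 + cycleSign b S C) =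
      ∑ u ∈ Fintype.piFinset fun i => range (#{x | b x = i} + 1),
        ((∏ i, (#{x | b x = i}).choose (u i) : ℕ) : ℤ) * ((-1) ^ (∑ i, u i) *
          if ∀ i ∉ S, u i ≤ 1 then
            (((Fintype.card α - ∑ i, u i).factorial * ∏ i, (u i).factorial : ℕ) : ℤ) else 0) := by
  rw [← sum_card_fibers b fun u => (-1) ^ (∑ i, u i) * if ∀ i ∉ S, u i ≤ 1 then
    (((Fintype.card α - ∑ i, u i).factorial * ∏ i, (u i).factorial : ℕ) : ℤ) else 0]
  simp_rw [sum_powerset_small_eq, sum_filter]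
  rw [sum_comm]
  refine sum_congr rfl fun U _ => ?_
  rw [← sum_filter, sum_prod_cycleSign]
  have : #U = ∑ i, #{x ∈ U | b x = i} := card_eq_sum_card_fiberwise fun x _ => mem_univ (b x)
  rw [← this]

end Expansion
end BlockDerangement

namespace BlockDerangement

open Finset

/-! ### Two-row arrays: inserting and deleting fixed points. -/

section TwoRow

variable {ι : Type*} [LinearOrder ι]

/-- The number of occurrences of `j` in the top row of a two-row array. -/
def topCount (j : ι) (L : List (ι × ι)) : ℕ := L.countP fun p => p.1 = j

/-- The number of occurrences of `j` in the bottom row of a two-row array. -/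
def botCount (j : ι) (L : List (ι × ι)) : ℕ := L.countP fun p => p.2 = j

@[simp] theorem topCount_nil (j : ι) : topCount j [] = 0 := rfl
@[simp] theorem botCount_nil (j : ι) : botCount j [] = 0 := rfl
@[simp] theorem topCount_append (j : ι) (u v : List (ι × ι)) :
    topCount j (u ++ v) = topCount j u + topCount j v := by simp [topCount]
@[simp] theorem botCount_append (j : ι) (u v : List (ι × ι)) :
    botCount j (u ++ v) = botCount j u + botCount j v := by simp [botCount]
@[simp] theorem topCount_cons (j : ι) (p : ι × ι) (v : List (ι × ι)) :
    topCount j (p :: v) = topCount j v + if p.1 = j then 1 else 0 := by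
  simp [topCount, List.countP_cons]
@[simp] theorem botCount_cons (j : ι) (p : ι × ι) (v : List (ι × ι)) :
    botCount j (p :: v) = botCount j v + if p.2 = j then 1 else 0 := by
  simp [botCount, List.countP_cons]

theorem topCount_eq_zero {j : ι} {L : List (ι × ι)} (h : ∀ p ∈ L, p.1 ≠ j) :
    topCount j L = 0 := by
  simpa [topCount] using h

theorem topCount_eq_length {j : ι} {L : List (ι × ι)} (h : ∀ p ∈ L, p.1 = j) :
    topCount j L = L.length := by
  simpa [topCount] using h

/-- A split of an array at which a column `(j, j)` corresponds to a fixed point in block `j`. -/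
def Balanced (S : Finset ι) (j : ι) (u v : List (ι × ι)) : Prop :=
  if j ∈ S then topCount j u = botCount j v else topCount j u = botCount j u

/-- The permutation encoded by a two-row array has a fixed point in block `j`. -/
def HasFix (S : Finset ι) (j : ι) (L : List (ι × ι)) : Prop :=
  ∃ u v, L = u ++ (j, j) :: v ∧ Balanced S j u v

/-- The top row is weakly increasing. -/
def TopSorted (L : List (ι × ι)) : Prop := L.Pairwise fun p q => p.1 ≤ q.1

/-- A column (i, i) contributes to no count of j, so fixed points in other blocks survive unchanged.
-/
theorem hasFix_insert_iff {S : Finset ι} {i j : ι} (hij : i ≠ j) (u v : List (ι × ι)) :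
    HasFix S j (u ++ (i, i) :: v) ↔ HasFix S j (u ++ v) := by
  constructor
  · rintro ⟨u', v', h, hb⟩
    obtain ⟨t, rfl, ht⟩ | ⟨t, rfl, ht⟩ := List.append_eq_append_iff.1 h
    · cases t with
      | nil => simp at ht; exact absurd ht.1 hij
      | cons p t =>
        obtain ⟨rfl, rfl⟩ : (i, i) = p ∧ v = t ++ (j, j) :: v' := by simpa using ht
        exact ⟨u ++ t, v', by simp, by simpa [Balanced, hij] using hb⟩
    · cases t with
      | nil => simp at ht; exact absurd ht.1.symm hij
      | cons p t =>
        obtain ⟨rfl, rfl⟩ : (j, j) = p ∧ v' = t ++ (i, i) :: v := by simpa using ht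
        exact ⟨u', t ++ v, by simp, by simpa [Balanced, hij] using hb⟩
  · rintro ⟨u', v', h, hb⟩
    obtain ⟨t, rfl, ht⟩ | ⟨t, rfl, ht⟩ := List.append_eq_append_iff.1 h
    · subst ht
      exact ⟨u ++ (i, i) :: t, v', by simp, by simpa [Balanced, hij] using hb⟩
    · cases t with
      | nil =>
        obtain rfl : (j, j) :: v' = v := by simpa using ht
        exact ⟨u' ++ [(i, i)], v', by simp, by simpa [Balanced, hij] using hb⟩
      | cons p t =>
        obtain ⟨rfl, rfl⟩ : (j, j) = p ∧ v' = t ++ v := by simpa using ht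
        exact ⟨u', t ++ (i, i) :: v, by simp, by simpa [Balanced, hij] using hb⟩

theorem TopSorted.exists_split {L : List (ι × ι)} (h : TopSorted L) (i : ι) :
    ∃ u v, L = u ++ v ∧ (∀ p ∈ u, p.1 < i) ∧ ∀ p ∈ v, i ≤ p.1 := by
  induction L with
  | nil => exact ⟨[], [], by simp⟩
  | cons p L ih =>
    obtain ⟨hp, hL⟩ := List.pairwise_cons.1 h
    by_cases hpi : p.1 < i
    · obtain ⟨u, v, rfl, hu, hv⟩ := ih hL
      refine ⟨p :: u, v, rfl, ?_, hv⟩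
      simpa [hpi] using hu
    · refine ⟨[], p :: L, rfl, by simp, ?_⟩
      intro q hq
      rcases List.mem_cons.1 hq with rfl | hq
      · exact not_lt.1 hpi
      · exact (not_lt.1 hpi).trans (hp q hq)

theorem topSorted_insert_iff {i : ι} {u v : List (ι × ι)} :
    TopSorted (u ++ (i, i) :: v) ↔
      TopSorted (u ++ v) ∧ (∀ p ∈ u, p.1 ≤ i) ∧ ∀ p ∈ v, i ≤ p.1 := by
  simp only [TopSorted, List.pairwise_append, List.pairwise_cons, List.mem_cons, forall_eq_or_imp]
  grind

/-- Discrete continuity: as the split moves right through block i, `topCount i u - botCount i u`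
rises by 0 or 1 per column. It starts nonpositive and is nonnegative once the block is exhausted, so
it vanishes somewhere. -/
theorem exists_balanced_ascending (i : ι) (v : List (ι × ι)) : ∀ u : List (ι × ι),
    TopSorted v → (∀ p ∈ u, p.1 ≤ i) → (∀ p ∈ v, i ≤ p.1) → topCount i u ≤ botCount i u →
    topCount i u + topCount i v = botCount i u + botCount i v →
    ∃ u' v', u ++ v = u' ++ v' ∧ (∀ p ∈ u', p.1 ≤ i) ∧ (∀ p ∈ v', i ≤ p.1) ∧
      topCount i u' = botCount i u' := by
  induction v with
  | nil =>
    intro u _ hu hv _ htot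
    exact ⟨u, [], rfl, hu, hv, by simpa using htot⟩
  | cons p v ih =>
    intro u hs hu hv hle htot
    obtain ⟨hp, hs'⟩ := List.pairwise_cons.1 hs
    rcases hle.eq_or_lt with heq | hlt
    · exact ⟨u, p :: v, rfl, hu, hv, heq⟩
    by_cases hpi : p.1 = i
    · obtain ⟨u', v', h1, h2⟩ := ih (u ++ [p]) hs' (by simpa [or_imp, forall_and, hpi] using hu)
        (fun q hq => hv q (List.mem_cons_of_mem _ hq)) (by simp [hpi]; split_ifs <;> omega)
        (by simp at htot ⊢; omega)
      exact ⟨u', v', by simpa using h1, h2⟩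
    · have h0 : topCount i (p :: v) = 0 := by
        have hip := lt_of_le_of_ne (hv p List.mem_cons_self) (Ne.symm hpi)
        refine topCount_eq_zero fun q hq => ?_
        rcases List.mem_cons.1 hq with rfl | hq
        · exact hpi
        · exact (hip.trans_le (hp q hq)).ne'
      omega

/-- Here `topCount i u - botCount i v` rises by 1 or 2 per column. It can skip 0 only by jumping
from -1 to 1, and the column crossed is then a fixed point. -/
theorem exists_balanced_descending (i : ι) (v : List (ι × ι)) : ∀ u : List (ι × ι),
    TopSorted v → (∀ p ∈ u, p.1 ≤ i) → (∀ p ∈ v, i ≤ p.1) → topCount i u ≤ botCount i v →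
    topCount i u + topCount i v = botCount i u + botCount i v →
    (∃ u' v', u ++ v = u' ++ (i, i) :: v' ∧ topCount i u' = botCount i v') ∨
    ∃ u' v', u ++ v = u' ++ v' ∧ (∀ p ∈ u', p.1 ≤ i) ∧ (∀ p ∈ v', i ≤ p.1) ∧
      topCount i u' = botCount i v' := by
  induction v with
  | nil =>
    intro u _ hu hv hle htot
    exact Or.inr ⟨u, [], rfl, hu, hv, by simpa using hle⟩
  | cons p v ih =>
    intro u hs hu hv hle htot
    obtain ⟨hp, hs'⟩ := List.pairwise_cons.1 hs
    rcases hle.eq_or_lt with heq | hlt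
    · exact Or.inr ⟨u, p :: v, rfl, hu, hv, heq⟩
    by_cases hpi : p.1 = i
    · by_cases hfix : p.2 = i ∧ topCount i u = botCount i v
      · exact Or.inl ⟨u, v, by rw [← (Prod.ext hpi hfix.1 : p = (i, i))], hfix.2⟩
      · have := ih (u ++ [p]) hs' (by simpa [or_imp, forall_and, hpi] using hu)
          (fun q hq => hv q (List.mem_cons_of_mem _ hq))
          (by simp [hpi] at hlt hle hfix ⊢; split_ifs at hlt <;> grind)
          (by simp at htot ⊢; omega)
        simpa using this
    · have h0 : topCount i (p :: v) = 0 := by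
        have hip := lt_of_le_of_ne (hv p List.mem_cons_self) (Ne.symm hpi)
        refine topCount_eq_zero fun q hq => ?_
        rcases List.mem_cons.1 hq with rfl | hq
        · exact hpi
        · exact (hip.trans_le (hp q hq)).ne'
      omega

theorem TopSorted.exists_insert {S : Finset ι} {i : ι} {L : List (ι × ι)} (hL : TopSorted L)
    (htot : topCount i L = botCount i L) (hfix : i ∈ S → ¬ HasFix S i L) :
    ∃ u v, L = u ++ v ∧ TopSorted (u ++ (i, i) :: v) ∧ Balanced S i u v := by
  obtain ⟨u, v, rfl, hu, hv⟩ := hL.exists_split i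
  have h0 : topCount i u = 0 := topCount_eq_zero fun p hp => (hu p hp).ne
  have hs : TopSorted v := (List.pairwise_append.1 hL).2.1
  simp only [topCount_append, botCount_append] at htot
  by_cases hi : i ∈ S
  · rcases exists_balanced_descending i v u hs (fun p hp => (hu p hp).le) hv (by omega) htot with
      ⟨u', v', h, hb⟩ | ⟨u', v', h, hu', hv', hb⟩
    · exact absurd ⟨u', v', h, by simpa [Balanced, hi] using hb⟩ (hfix hi)
    · exact ⟨u', v', h, topSorted_insert_iff.2 ⟨h ▸ hL, hu', hv'⟩, by simpa [Balanced, hi] using hb⟩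
  · obtain ⟨u', v', h, hu', hv', hb⟩ := exists_balanced_ascending i v u hs
      (fun p hp => (hu p hp).le) hv (by omega) htot
    exact ⟨u', v', h, topSorted_insert_iff.2 ⟨h ▸ hL, hu', hv'⟩, by simpa [Balanced, hi] using hb⟩

theorem eq_replicate_of_counts {i : ι} {t : List (ι × ι)} (h1 : ∀ p ∈ t, p.1 = i)
    (h2 : botCount i t = t.length) : t = List.replicate t.length (i, i) := by
  refine List.eq_replicate_iff.2 ⟨rfl, fun p hp => ?_⟩
  have := (List.countP_eq_length.1 h2) p hp
  exact Prod.ext (h1 p hp) (by simpa using this)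

theorem replicate_append_cons {γ : Type*} (m : ℕ) (x : γ) (v : List γ) :
    List.replicate m x ++ x :: v = x :: (List.replicate m x ++ v) := by
  rw [← List.cons_append, ← List.replicate_succ, List.replicate_succ']
  simp

/-- The columns t between two admissible positions have top entry i. In the descending case the two
balances force t to be empty; in the ascending case every column of t is (i, i), so both insertions
lengthen the same run. -/
theorem insert_unique {S : Finset ι} {i : ι} {u₁ v₁ u₂ v₂ : List (ι × ι)}
    (h : u₁ ++ v₁ = u₂ ++ v₂) (hs₁ : TopSorted (u₁ ++ (i, i) :: v₁))
    (hs₂ : TopSorted (u₂ ++ (i, i) :: v₂)) (hb₁ : Balanced S i u₁ v₁) (hb₂ : Balanced S i u₂ v₂) :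
    u₁ ++ (i, i) :: v₁ = u₂ ++ (i, i) :: v₂ := by
  wlog hle : ∃ t, u₁ = u₂ ++ t ∧ v₂ = t ++ v₁ generalizing u₁ v₁ u₂ v₂
  · obtain ⟨t, h1, h2⟩ | ⟨t, h1, h2⟩ := List.append_eq_append_iff.1 h
    · exact (this h.symm hs₂ hs₁ hb₂ hb₁ ⟨t, h1, h2⟩).symm
    · exact absurd ⟨t, h1, h2⟩ hle
  obtain ⟨t, rfl, rfl⟩ := hle
  have h1 := (topSorted_insert_iff.1 hs₁).2.1
  have h2 := (topSorted_insert_iff.1 hs₂).2.2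
  have ht : ∀ p ∈ t, p.1 = i := fun p hp =>
    le_antisymm (h1 p (by simp [hp])) (h2 p (by simp [hp]))
  have hlen := topCount_eq_length ht
  unfold Balanced at hb₁ hb₂
  split_ifs at hb₁ hb₂
  · simp only [topCount_append, botCount_append] at hb₁ hb₂
    obtain rfl : t = [] := List.length_eq_zero_iff.1 (by omega)
    simp
  · simp only [topCount_append, botCount_append] at hb₁ hb₂
    rw [eq_replicate_of_counts ht (by omega), List.append_assoc, replicate_append_cons]

/-- A descending block has at most one fixed point. Two fixed points of an ascending block are
separated only by columns (i, i), so deleting either gives the same array. -/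
theorem delete_unique {S : Finset ι} {i : ι} {u₁ v₁ u₂ v₂ : List (ι × ι)}
    (h : u₁ ++ (i, i) :: v₁ = u₂ ++ (i, i) :: v₂) (hs : TopSorted (u₁ ++ (i, i) :: v₁))
    (hb₁ : Balanced S i u₁ v₁) (hb₂ : Balanced S i u₂ v₂) :
    u₁ ++ v₁ = u₂ ++ v₂ := by
  wlog hle : ∃ t, u₁ = u₂ ++ t ∧ (i, i) :: v₂ = t ++ (i, i) :: v₁ generalizing u₁ v₁ u₂ v₂
  · obtain ⟨t, h1, h2⟩ | ⟨t, h1, h2⟩ := List.append_eq_append_iff.1 h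
    · exact (this h.symm (h ▸ hs) hb₂ hb₁ ⟨t, h1, h2⟩).symm
    · exact absurd ⟨t, h1, h2⟩ hle
  obtain ⟨t, rfl, ht⟩ := hle
  cases t with
  | nil => simp at ht; simp [ht]
  | cons p t =>
    obtain ⟨rfl, rfl⟩ : (i, i) = p ∧ v₂ = t ++ (i, i) :: v₁ := by simpa using ht
    have h1 := (topSorted_insert_iff.1 hs).2.1
    have h2 := (topSorted_insert_iff.1 (h ▸ hs)).2.2
    have ht : ∀ p ∈ t, p.1 = i := fun p hp =>
      le_antisymm (h1 p (by simp [hp])) (h2 p (by simp [hp]))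
    have hlen := topCount_eq_length ht
    unfold Balanced at hb₁ hb₂
    split_ifs at hb₁ hb₂
    · simp at hb₁ hb₂
      omega
    · simp at hb₁ hb₂
      rw [eq_replicate_of_counts ht (by omega), List.append_assoc, List.cons_append,
        replicate_append_cons]

/-- The top count to the left is nondecreasing and the bottom count to the right nonincreasing as
the split moves. They agree at the deletion point, so they cannot agree around another column (i,
i), which would change both. -/
theorem not_hasFix_delete {S : Finset ι} {i : ι} (hi : i ∈ S) {u v : List (ι × ι)}
    (hb : Balanced S i u v) : ¬ HasFix S i (u ++ v) := by
  rintro ⟨u', v', h, hb'⟩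
  simp only [Balanced, hi, if_true] at hb hb'
  obtain ⟨t, rfl, ht⟩ | ⟨t, rfl, ht⟩ := List.append_eq_append_iff.1 h
  · subst ht
    simp at hb hb'
    omega
  · cases t with
    | nil =>
      obtain rfl : (i, i) :: v' = v := by simpa using ht
      simp at hb hb'
      omega
    | cons p t =>
      obtain ⟨rfl, rfl⟩ : (i, i) = p ∧ v' = t ++ v := by simpa using ht
      simp at hb hb'
      omega

/-! ### Counting arrays without fixed points, block by block. -/

/-- The two-row arrays with content `a` in both rows and increasing top row. -/
def arrays (a : ι → ℕ) : Set (List (ι × ι)) :=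
  {L | TopSorted L ∧ ∀ j, topCount j L = a j ∧ botCount j L = a j}

/-- The arrays that encode permutations without fixed points in the blocks of `D`. -/
def fixFreeArrays (S D : Finset ι) (a : ι → ℕ) : Set (List (ι × ι)) :=
  {L | L ∈ arrays a ∧ ∀ j ∈ D, ¬ HasFix S j L}

theorem length_eq_sum_topCount [Fintype ι] (L : List (ι × ι)) :
    L.length = ∑ j, topCount j L := by
  induction L with
  | nil => simp
  | cons p L ih => simp [sum_add_distrib, ih]

theorem finite_arrays [Fintype ι] (a : ι → ℕ) : (arrays a).Finite := by
  refine (List.finite_length_eq (ι × ι) (∑ j, a j)).subset fun L hL => ?_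
  simp only [Set.mem_ofPred_eq, length_eq_sum_topCount, (hL.2 _).1]

/-- Suited to deletion of a fixed point, where the column removed is not canonical but the resulting
array is. -/
theorem ncard_eq_of_rel {β γ : Type*} {s : Set β} {t : Set γ} (r : β → γ → Prop)
    (hs : ∀ x ∈ s, ∃ y ∈ t, r x y) (ht : ∀ y ∈ t, ∃ x ∈ s, r x y)
    (hl : ∀ x ∈ s, ∀ x' ∈ s, ∀ y, r x y → r x' y → x = x')
    (hr : ∀ x ∈ s, ∀ y y', r x y → r x y' → y = y') : s.ncard = t.ncard := by
  choose f hft hfr using hs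
  refine Set.ncard_congr f hft ?_ ?_
  · intro x x' hx hx' h
    exact hl x hx x' hx' _ (hfr x hx) (h ▸ hfr x' hx')
  · intro y hy
    obtain ⟨x, hx, hxy⟩ := ht y hy
    exact ⟨x, hx, hr x hx _ _ (hfr x hx) hxy⟩

theorem ncard_hasFix (S D : Finset ι) {i : ι} (hiD : i ∉ D) (a : ι → ℕ) :
    {L | L ∈ fixFreeArrays S D (Function.update a i (a i + 1)) ∧ HasFix S i L}.ncard =
      (fixFreeArrays S (if i ∈ S then insert i D else D) a).ncard := by
  have hcount : ∀ u v : List (ι × ι),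
      (∀ j, topCount j (u ++ (i, i) :: v) = Function.update a i (a i + 1) j ∧
        botCount j (u ++ (i, i) :: v) = Function.update a i (a i + 1) j) ↔
      ∀ j, topCount j (u ++ v) = a j ∧ botCount j (u ++ v) = a j := by
    intro u v
    refine forall_congr' fun j => ?_
    by_cases hj : j = i
    · subst hj
      simp
      omega
    · simp [hj, Ne.symm hj]
  have hD : ∀ u v : List (ι × ι), (∀ j ∈ D, ¬ HasFix S j (u ++ (i, i) :: v)) ↔
      ∀ j ∈ D, ¬ HasFix S j (u ++ v) := fun u v => forall₂_congr fun j hj => by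
    rw [hasFix_insert_iff (ne_of_mem_of_not_mem hj hiD).symm]
  refine ncard_eq_of_rel
    (fun L L' => ∃ u v, L = u ++ (i, i) :: v ∧ L' = u ++ v ∧ Balanced S i u v) ?_ ?_ ?_ ?_
  · rintro L ⟨⟨⟨hs, hc⟩, hf⟩, u, v, rfl, hb⟩
    refine ⟨u ++ v, ⟨⟨(topSorted_insert_iff.1 hs).1, (hcount u v).1 hc⟩, ?_⟩, u, v, rfl, rfl, hb⟩
    have := (hD u v).1 hf
    split_ifs with hi
    · simpa using ⟨not_hasFix_delete hi hb, this⟩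
    · exact this
  · rintro L ⟨⟨hs, hc⟩, hf⟩
    have hDf : ∀ j ∈ D, ¬ HasFix S j L := fun j hj => hf j (by split_ifs <;> simp [hj])
    obtain ⟨u, v, rfl, hs', hb⟩ := hs.exists_insert (S := S) (i := i)
      ((hc i).1.trans (hc i).2.symm) (fun hi => hf i (by simp [hi]))
    exact ⟨u ++ (i, i) :: v, ⟨⟨⟨hs', (hcount u v).2 hc⟩, (hD u v).2 hDf⟩, u, v, rfl, hb⟩,
      u, v, rfl, rfl, hb⟩
  · rintro _ ⟨⟨⟨hs, -⟩, -⟩, -⟩ _ ⟨⟨⟨hs', -⟩, -⟩, -⟩ _ ⟨u, v, rfl, rfl, hb⟩ ⟨u', v', rfl, h, hb'⟩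
    exact insert_unique h hs hs' hb hb'
  · rintro _ ⟨⟨⟨hs, -⟩, -⟩, -⟩ _ _ ⟨u, v, rfl, rfl, hb⟩ ⟨u', v', h, rfl, hb'⟩
    exact delete_unique h hs hb hb'

theorem ncard_fixFreeArrays_insert [Fintype ι] (S D : Finset ι) (i : ι) (a : ι → ℕ) :
    (fixFreeArrays S (insert i D) a).ncard +
      {L | L ∈ fixFreeArrays S D a ∧ HasFix S i L}.ncard = (fixFreeArrays S D a).ncard := by
  have hfin : (fixFreeArrays S D a).Finite := (finite_arrays a).subset fun L hL => hL.1
  rw [← Set.ncard_union_eq _ (hfin.subset _) (hfin.subset _)]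
  · congr 1
    ext L
    simp only [fixFreeArrays, Set.mem_union, Set.mem_ofPred_eq, mem_insert, forall_eq_or_imp]
    tauto
  · rw [Set.disjoint_left]
    exact fun L h h' => h.2 i (mem_insert_self _ _) h'.2
  · exact fun L h => ⟨h.1, fun j hj => h.2 j (mem_insert_of_mem hj)⟩
  · exact fun L h => h.1

/-- The numbers of columns `(i, i)` that may be removed from a block of length `m`. -/
def removals (S : Finset ι) (i : ι) (m : ℕ) : Finset ℕ := (range (m + 1)).filter fun t => i ∉ S → t ≤ 1

theorem ncard_insert_eq_sum [Fintype ι] (S D : Finset ι) {i : ι} (hiD : i ∉ D) (a : ι → ℕ) (m : ℕ) :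
    ((fixFreeArrays S (insert i D) (Function.update a i m)).ncard : ℤ) =
      ∑ t ∈ removals S i m, (-1) ^ t *
        ((fixFreeArrays S D (Function.update a i (m - t))).ncard : ℤ) := by
  have hzero : (fixFreeArrays S (insert i D) (Function.update a i 0)).ncard =
      (fixFreeArrays S D (Function.update a i 0)).ncard := by
    rw [← ncard_fixFreeArrays_insert S D i]
    convert (Nat.add_zero _).symm
    rw [Set.ncard_eq_zero ((finite_arrays (Function.update a i 0)).subset fun L hL => hL.1.1)]
    refine Set.eq_empty_of_forall_notMem ?_
    rintro _ ⟨⟨⟨-, hc⟩, -⟩, u, v, rfl, -⟩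
    simpa using (hc i).1
  have hsucc : ∀ m, ((fixFreeArrays S (insert i D) (Function.update a i (m + 1))).ncard : ℤ) =
      (fixFreeArrays S D (Function.update a i (m + 1))).ncard -
        (fixFreeArrays S (if i ∈ S then insert i D else D) (Function.update a i m)).ncard := by
    intro m
    have h := ncard_hasFix S D hiD (Function.update a i m)
    simp only [Function.update_self, Function.update_idem] at h
    rw [← h, ← ncard_fixFreeArrays_insert S D i]
    push_cast
    ring
  by_cases hi : i ∈ S
  · simp only [removals, hi, not_true_eq_false, false_imp_iff, filter_true, if_true] at hsucc ⊢
    induction m with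
    | zero => simp [hzero]
    | succ m ih =>
      -- Term t of the sum for m is the negative of term t + 1 of the sum for m + 1; only t = 0 is
      -- new.
      rw [hsucc, ih, sum_range_succ' _ (m + 1)]
      simp only [pow_succ, Nat.add_sub_add_right, mul_neg_one, neg_mul, sum_neg_distrib]
      simp only [pow_zero, one_mul, Nat.sub_zero]
      ring
  · simp only [hi, if_false] at hsucc
    cases m with
    | zero =>
      have : removals S i 0 = {0} := by ext t; simp [removals]; omega
      simp [hzero, this]
    | succ m =>
      have : removals S i (m + 1) = {0, 1} := by ext t; simp [removals, hi]; omega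
      rw [hsucc, this, sum_pair (by norm_num)]
      simp [sub_eq_add_neg]

theorem ncard_fixFreeArrays_eq_sum [Fintype ι] (S D : Finset ι) (a : ι → ℕ) :
    ((fixFreeArrays S D a).ncard : ℤ) =
      ∑ u ∈ Fintype.piFinset fun i => if i ∈ D then removals S i (a i) else {0},
        (-1) ^ (∑ i, u i) * ((arrays (a - u)).ncard : ℤ) := by
  induction D using Finset.induction_on generalizing a with
  | empty =>
    have : (Fintype.piFinset fun _ : ι => ({0} : Finset ℕ)) = {0} := by
      ext u; simp [funext_iff]
    simp [fixFreeArrays, this]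
  | insert i D hiD ih =>
    have h := ncard_insert_eq_sum S D hiD a (a i)
    rw [Function.update_eq_self] at h
    rw [h]
    simp_rw [ih]
    have hpi : ∀ m, (Fintype.piFinset fun j => if j ∈ D then
        removals S j (Function.update a i m j) else {0}) =
        Fintype.piFinset fun j => if j ∈ D then removals S j (a j) else {0} := by
      intro m
      congr 1
      funext j
      split_ifs with hj
      · rw [Function.update_of_ne (ne_of_mem_of_not_mem hj hiD)]
      · rfl
    simp_rw [hpi, mul_sum]
    rw [← sum_product']
    -- Coordinate i is still 0 in the vectors for D, so it is free to store the number t removed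
    -- from block i.
    have hui : ∀ u : ι → ℕ, u ∈ (Fintype.piFinset fun j => if j ∈ D then removals S j (a j) else {0})
        → u i = 0 := by
      intro u hu
      simpa [hiD] using Fintype.mem_piFinset.1 hu i
    refine sum_nbij' (fun p => Function.update p.2 i p.1) (fun u => (u i, Function.update u i 0))
      ?_ ?_ ?_ ?_ ?_
    · rintro ⟨t, u⟩ h
      obtain ⟨ht, hu⟩ := mem_product.1 h
      refine Fintype.mem_piFinset.2 fun j => ?_
      by_cases hj : j = i
      · subst hj; simpa using ht
      · simpa [hj] using Fintype.mem_piFinset.1 hu j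
    · intro u hu
      refine mem_product.2 ⟨by simpa using Fintype.mem_piFinset.1 hu i,
        Fintype.mem_piFinset.2 fun j => ?_⟩
      by_cases hj : j = i
      · subst hj; simp [hiD]
      · simpa [hj] using Fintype.mem_piFinset.1 hu j
    · rintro ⟨t, u⟩ h
      have := hui u (mem_product.1 h).2
      simp [Function.update_idem, ← this]
    · intro u _
      simp
    · rintro ⟨t, u⟩ h
      have h0 := hui u (mem_product.1 h).2
      rw [sum_update_of_mem (mem_univ i), ← mul_assoc, ← pow_add]
      congr 2
      · rw [← sum_erase univ h0, ← sdiff_singleton_eq_erase]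
      · congr 2
        funext j
        by_cases hj : j = i
        · subst hj; simp [h0]
        · simp [hj]

end TwoRow
end BlockDerangement

namespace BlockDerangement

open Finset

/-! ### Encoding permutations by arrays. -/

section Encoding

theorem countP_take_ofFn {γ : Type*} (p : γ → Bool) {n : ℕ} (g : Fin n → γ) (m : ℕ) :
    ((List.ofFn g).take m).countP p = #{x : Fin n | x.val < m ∧ p (g x)} := by
  induction n generalizing m with
  | zero => simp
  | succ n ih =>
    cases m with
    | zero => simp
    | succ m =>
      rw [List.ofFn_succ, List.take_succ_cons, List.countP_cons, ih, card_filter, card_filter,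
        Fin.sum_univ_succ]
      simp [add_comm]

theorem countP_drop_ofFn {γ : Type*} (p : γ → Bool) {n : ℕ} (g : Fin n → γ) (m : ℕ) :
    ((List.ofFn g).drop m).countP p = #{x : Fin n | m ≤ x.val ∧ p (g x)} := by
  induction n generalizing m with
  | zero => simp
  | succ n ih =>
    cases m with
    | zero =>
      have := ih (fun i => g i.succ) 0
      simp only [List.drop_zero] at this
      rw [List.drop_zero, List.ofFn_succ, List.countP_cons, this, card_filter, card_filter,
        Fin.sum_univ_succ]
      simp [add_comm]
    | succ m =>
      rw [List.ofFn_succ, List.drop_succ_cons, ih, card_filter, card_filter, Fin.sum_univ_succ]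
      simp

variable {ι : Type*} [LinearOrder ι] {n : ℕ} (b : Fin n → ι)

/-- The two-row array with rows `b` and `w`. -/
def twoRow (w : Fin n → ι) : List (ι × ι) := List.ofFn fun x => (b x, w x)

omit [LinearOrder ι] in
theorem twoRow_injective : Function.Injective (twoRow b) := by
  intro w w' h
  funext x
  exact congrArg Prod.snd (congrFun (List.ofFn_injective h) x)

theorem topCount_twoRow (w : Fin n → ι) (j : ι) : topCount j (twoRow b w) = #{x | b x = j} := by
  have := countP_drop_ofFn (fun p : ι × ι => decide (p.1 = j)) (fun x => (b x, w x)) 0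
  simpa [twoRow, topCount] using this

theorem botCount_twoRow (w : Fin n → ι) (j : ι) : botCount j (twoRow b w) = #{x | w x = j} := by
  have := countP_drop_ofFn (fun p : ι × ι => decide (p.2 = j)) (fun x => (b x, w x)) 0
  simpa [twoRow, botCount] using this

theorem hasFix_twoRow_iff (S : Finset ι) (w : Fin n → ι) (j : ι) :
    HasFix S j (twoRow b w) ↔ ∃ x, b x = j ∧ w x = j ∧
      if j ∈ S then #{y | y < x ∧ b y = j} = #{y | x < y ∧ w y = j}
      else #{y | y < x ∧ b y = j} = #{y | y < x ∧ w y = j} := by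
  have hcounts : ∀ x : Fin n,
      Balanced S j ((twoRow b w).take x) ((twoRow b w).drop (x + 1)) ↔
      if j ∈ S then #{y | y < x ∧ b y = j} = #{y | x < y ∧ w y = j}
      else #{y | y < x ∧ b y = j} = #{y | y < x ∧ w y = j} := by
    intro x
    simp [Balanced, twoRow, topCount, botCount, countP_take_ofFn, countP_drop_ofFn]
  have hlen : (twoRow b w).length = n := by simp [twoRow]
  constructor
  · rintro ⟨u, v, h, hb⟩
    have hu : u.length < n := by rw [← hlen, h]; simp
    have hget : (twoRow b w)[u.length]'(by rw [hlen]; exact hu) = (j, j) := by simp [h]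
    have hx : b ⟨u.length, hu⟩ = j ∧ w ⟨u.length, hu⟩ = j := by
      simpa [twoRow] using hget
    refine ⟨⟨u.length, hu⟩, hx.1, hx.2, (hcounts _).1 ?_⟩
    convert hb
    · simp [h]
    · simp [h]
  · rintro ⟨x, hbx, hwx, h⟩
    refine ⟨_, _, ?_, (hcounts x).2 h⟩
    have hget : (twoRow b w)[x.val]'(by rw [hlen]; exact x.2) = (j, j) := by simp [twoRow, hbx, hwx]
    rw [← hget, List.getElem_cons_drop, List.take_append_drop]

/-- The top row is sorted and has the same content as the sorted word b, hence equals it. -/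
theorem exists_eq_twoRow (hb : Monotone b) {a : ι → ℕ} (ha : ∀ i, #{x | b x = i} = a i)
    {L : List (ι × ι)} (hL : L ∈ arrays a) : ∃ w : Fin n → ι, L = twoRow b w := by
  have hperm : (L.map Prod.fst).Perm (List.ofFn b) := by
    rw [List.perm_iff_count]
    intro i
    have h1 : (L.map Prod.fst).count i = topCount i L := by
      rw [List.count, List.countP_map, topCount]
      rfl
    have h2 : (List.ofFn b).count i = #{x | b x = i} := by
      have := countP_drop_ofFn (fun j : ι => j == i) b 0
      simpa [List.count] using this
    rw [h1, h2, ha, (hL.2 i).1]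
  have hfst : L.map Prod.fst = List.ofFn b := by
    refine hperm.eq_of_pairwise' (r := (· ≤ ·)) ?_ ?_
    · exact List.pairwise_map.2 hL.1
    · exact List.pairwise_ofFn.2 fun i j hij => hb hij.le
  have hlen : L.length = n := by simpa using congrArg List.length hfst
  subst hlen
  refine ⟨fun x => (L.get x).2, ?_⟩
  refine List.ext_getElem (by simp [twoRow]) fun m h1 h2 => ?_
  have : (L.map Prod.fst)[m]'(by simpa using h1) = b ⟨m, h1⟩ := by simp [hfst]
  simp only [List.getElem_map] at this
  simp [twoRow, ← this]

theorem twoRow_mem_arrays (hb : Monotone b) {a : ι → ℕ} (ha : ∀ i, #{x | b x = i} = a i)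
    {w : Fin n → ι} : twoRow b w ∈ arrays a ↔ ∀ i, #{x | w x = i} = a i := by
  have hs : TopSorted (twoRow b w) := List.pairwise_ofFn.2 fun i j hij => hb hij.le
  simp only [arrays, Set.mem_ofPred_eq, hs, true_and, topCount_twoRow, botCount_twoRow, ha]

theorem exists_perm_comp_eq {w : Fin n → ι} (h : ∀ i, #{x | w x = i} = #{x | b x = i}) :
    ∃ σ : Equiv.Perm (Fin n), b ∘ σ = w := by
  have e : ∀ i, Nonempty ({x // w x = i} ≃ {x // b x = i}) := fun i =>
    Fintype.card_eq.1 (by rw [Fintype.card_subtype, Fintype.card_subtype, h i])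
  exact ⟨Equiv.ofFiberEquiv fun i => (e i).some,
    funext fun x => Equiv.ofFiberEquiv_map (fun i => (e i).some) x⟩

theorem card_perm_comp_eq [Fintype ι] {w : Fin n → ι}
    (h : ∀ i, #{x | w x = i} = #{x | b x = i}) :
    #{σ : Equiv.Perm (Fin n) | b ∘ σ = w} = ∏ i, (#{x | b x = i}).factorial := by
  obtain ⟨σ₀, rfl⟩ := exists_perm_comp_eq b h
  have h1 : #{σ : Equiv.Perm (Fin n) | b ∘ σ = b} = ∏ i, (#{x | b x = i}).factorial := by
    rw [← Fintype.card_subtype, DomMulAct.stabilizer_card]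
    simp_rw [Fintype.card_subtype]
  rw [← h1]
  refine card_nbij' (fun σ => σ * σ₀⁻¹) (fun σ => σ * σ₀) ?_ ?_ ?_ ?_
  · intro σ hσ
    refine mem_filter.2 ⟨mem_univ _, funext fun x => ?_⟩
    have := congrFun (mem_filter.1 hσ).2 (σ₀⁻¹ x)
    simpa using this
  · intro σ hσ
    refine mem_filter.2 ⟨mem_univ _, funext fun x => ?_⟩
    have := congrFun (mem_filter.1 hσ).2 (σ₀ x)
    simpa using this
  · intro σ _; simp
  · intro σ _; simp

/-- The map σ ↦ b ∘ σ sends permutations onto the possible bottom rows, and each fibre has ∏ a_i!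
elements. -/
theorem ncard_arrays_mul [Fintype ι] (hb : Monotone b) {a : ι → ℕ}
    (ha : ∀ i, #{x | b x = i} = a i) :
    (arrays a).ncard * ∏ i, (a i).factorial = n.factorial := by
  have himage : arrays a = twoRow b '' {w | ∀ i, #{x | w x = i} = a i} := by
    ext L
    constructor
    · intro hL
      obtain ⟨w, rfl⟩ := exists_eq_twoRow b hb ha hL
      exact ⟨w, (twoRow_mem_arrays b hb ha).1 hL, rfl⟩
    · rintro ⟨w, hw, rfl⟩
      exact (twoRow_mem_arrays b hb ha).2 hw
  have hfinset : {w : Fin n → ι | ∀ i, #{x | w x = i} = a i} =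
      (univ.filter fun w : Fin n → ι => ∀ i, #{x | w x = i} = a i : Finset (Fin n → ι)) := by
    ext w; simp
  rw [himage, Set.ncard_image_of_injective _ (twoRow_injective b), hfinset, Set.ncard_coe_finset]
  have hcard := card_eq_sum_card_fiberwise (s := (univ : Finset (Equiv.Perm (Fin n))))
    (f := fun σ : Equiv.Perm (Fin n) => b ∘ σ) (t := univ.filter fun w : Fin n → ι => ∀ i, #{x | w x = i} = a i) ?_
  · rw [card_univ, Fintype.card_perm, Fintype.card_fin] at hcard
    rw [hcard, sum_congr rfl fun w hw => card_perm_comp_eq b (w := w) fun i => by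
      rw [ha, (mem_filter.1 hw).2 i], sum_const, smul_eq_mul]
    simp_rw [ha]
  · intro σ _
    refine mem_filter.2 ⟨mem_univ _, fun i => ?_⟩
    rw [← ha i]
    refine card_equiv σ fun x => ?_
    simp

/-- Strictly antitone on the fibers of `b` over `S`, strictly monotone on the other fibers. -/
def MonotoneOnFibers (S : Finset ι) (π : Fin n → Fin n) : Prop :=
  ∀ x y, b x = b y → x < y → if b x ∈ S then π y < π x else π x < π y

variable {b}

theorem MonotoneOnFibers.lt_iff {S : Finset ι} {π : Fin n → Fin n} (h : MonotoneOnFibers b S π)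
    {x y : Fin n} (hxy : b x = b y) :
    if b x ∈ S then π y < π x ↔ x < y else π x < π y ↔ x < y := by
  rcases lt_trichotomy x y with hlt | rfl | hlt
  · have := h x y hxy hlt
    split_ifs at this ⊢ <;> exact iff_of_true this hlt
  · simp
  · have := h y x hxy.symm hlt
    rw [← hxy] at this
    split_ifs at this ⊢ <;> exact iff_of_false this.not_gt hlt.not_gt

/-- The rank of x in its block can be read off from the word b ∘ π⁻¹ at position π x, counting from
the right for descending blocks. This recovers π from the word and turns fixed points into balanced
columns. -/
theorem MonotoneOnFibers.card_lt {S : Finset ι} {π : Equiv.Perm (Fin n)}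
    (h : MonotoneOnFibers b S π) (x : Fin n) :
    #{y | y < x ∧ b y = b x} =
      if b x ∈ S then #{z | π x < z ∧ b (π.symm z) = b x} else #{z | z < π x ∧ b (π.symm z) = b x} := by
  split_ifs with hx
  · refine card_equiv π fun y => ?_
    simp only [mem_filter, mem_univ, true_and, Equiv.symm_apply_apply]
    refine and_congr_left fun hy => ?_
    have := h.lt_iff hy
    rw [if_pos (hy ▸ hx)] at this
    exact this.symm
  · refine card_equiv π fun y => ?_
    simp only [mem_filter, mem_univ, true_and, Equiv.symm_apply_apply]
    refine and_congr_left fun hy => ?_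
    have := h.lt_iff hy
    rw [if_neg (hy ▸ hx)] at this
    exact this.symm

theorem eq_of_card_lt_eq {x y : Fin n} (hxy : b x = b y)
    (h : #{z | z < x ∧ b z = b x} = #{z | z < y ∧ b z = b x}) : x = y := by
  wlog hlt : x < y generalizing x y
  · rcases (not_lt.1 hlt).eq_or_lt with h' | h'
    · exact h'.symm
    · exact (this hxy.symm (by rw [← hxy, h]) h').symm
  refine absurd h (card_lt_card ?_).ne
  refine ssubset_iff_of_subset (fun z hz => ?_) |>.2 ⟨x, ?_, ?_⟩
  · simp only [mem_filter, mem_univ, true_and] at hz ⊢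
    exact ⟨hz.1.trans hlt, hz.2⟩
  · simp [hlt]
  · simp

theorem hasFix_twoRow_perm_iff {S : Finset ι} {π : Equiv.Perm (Fin n)}
    (h : MonotoneOnFibers b S π) (j : ι) :
    HasFix S j (twoRow b (b ∘ π.symm)) ↔ ∃ x, b x = j ∧ π x = x := by
  rw [hasFix_twoRow_iff]
  constructor
  · rintro ⟨x, rfl, hw, hc⟩
    have hw : b (π.symm x) = b x := hw
    have := h.card_lt (π.symm x)
    simp only [Equiv.apply_symm_apply, hw] at this
    have key : #{y | y < π.symm x ∧ b y = b x} = #{y | y < x ∧ b y = b x} := by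
      rw [this]
      split_ifs at hc ⊢ <;> exact hc.symm
    refine ⟨x, rfl, ?_⟩
    have := eq_of_card_lt_eq hw (by rw [hw, key])
    exact ((Equiv.symm_apply_eq π).1 this).symm
  · rintro ⟨x, rfl, hx⟩
    refine ⟨x, rfl, ?_, ?_⟩
    · simp [(Equiv.symm_apply_eq π).2 hx.symm]
    · have := h.card_lt x
      rw [hx] at this
      split_ifs at this ⊢ <;> exact this

theorem MonotoneOnFibers.eq_of_comp_inv_eq {S : Finset ι} {π ρ : Equiv.Perm (Fin n)}
    (hπ : MonotoneOnFibers b S π) (hρ : MonotoneOnFibers b S ρ) (h : b ∘ π.symm = b ∘ ρ.symm) :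
    π = ρ := by
  have h' : ∀ z, b (π.symm z) = b (ρ.symm z) := congrFun h
  suffices π.symm = ρ.symm from Equiv.symm_bijective.injective this
  refine Equiv.ext fun z => ?_
  refine eq_of_card_lt_eq (h' z) ?_
  have h1 := hπ.card_lt (π.symm z)
  have h2 := hρ.card_lt (ρ.symm z)
  simp only [Equiv.apply_symm_apply, h'] at h1 h2 ⊢
  rw [h1, h2]

theorem exists_monotoneOnFibers (S : Finset ι) {w : Fin n → ι}
    (h : ∀ i, #{x | w x = i} = #{x | b x = i}) :
    ∃ π : Equiv.Perm (Fin n), MonotoneOnFibers b S π ∧ b ∘ π.symm = w := by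
  have hb : ∀ i, Fintype.card {x // b x = i} = #{x | b x = i} := fun i => Fintype.card_subtype _
  have hw : ∀ i, Fintype.card {x // w x = i} = #{x | b x = i} := fun i => by
    rw [Fintype.card_subtype, h]
  -- Block i is matched with the positions of the letter i in w in increasing order, or in reverse
  -- order if i ∈ S.
  let e : ∀ i, {x // b x = i} ≃ {x // w x = i} := fun i =>
    (Fintype.orderIsoFinOfCardEq _ (hb i)).symm.toEquiv.trans
      ((if i ∈ S then Fin.revPerm else Equiv.refl _).trans
        (Fintype.orderIsoFinOfCardEq _ (hw i)).toEquiv)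
  have he : ∀ i (x y : {x // b x = i}), x < y → if i ∈ S then e i y < e i x else e i x < e i y := by
    intro i x y hxy
    by_cases hi : i ∈ S <;> simp [e, hi, hxy]
  refine ⟨Equiv.ofFiberEquiv e, ?_, ?_⟩
  · intro x y hxy hlt
    have := he (b x) ⟨x, rfl⟩ ⟨y, hxy.symm⟩ hlt
    have hy : Equiv.ofFiberEquiv e y = (e (b x) ⟨y, hxy.symm⟩ : Fin n) := by
      have : ∀ i (hi : b y = i), Equiv.ofFiberEquiv e y = (e i ⟨y, hi⟩ : Fin n) := by
        rintro i rfl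
        rfl
      exact this _ _
    rw [hy]
    exact this
  · funext z
    have := Equiv.ofFiberEquiv_map e ((Equiv.ofFiberEquiv e).symm z)
    rw [Equiv.apply_symm_apply] at this
    exact this.symm

theorem ncard_derangements_eq [Fintype ι] (hb : Monotone b) (S : Finset ι) {a : ι → ℕ}
    (ha : ∀ i, #{x | b x = i} = a i) :
    {π : Equiv.Perm (Fin n) | MonotoneOnFibers b S π ∧ ∀ x, π x ≠ x}.ncard =
      (fixFreeArrays S univ a).ncard := by
  refine Set.ncard_congr (fun π _ => twoRow b (b ∘ π.symm)) ?_ ?_ ?_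
  · rintro π ⟨hπ, hfix⟩
    refine ⟨(twoRow_mem_arrays b hb ha).2 fun i => ?_, fun j _ hj => ?_⟩
    · rw [← ha i]
      exact card_equiv π.symm fun x => by simp
    · obtain ⟨x, -, hx⟩ := (hasFix_twoRow_perm_iff hπ j).1 hj
      exact hfix x hx
  · rintro π ρ ⟨hπ, -⟩ ⟨hρ, -⟩ h
    exact hπ.eq_of_comp_inv_eq hρ (twoRow_injective b h)
  · rintro L ⟨hL, hf⟩
    obtain ⟨w, rfl⟩ := exists_eq_twoRow b hb ha hL
    obtain ⟨π, hπ, rfl⟩ := exists_monotoneOnFibers (b := b) S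
      (fun i => ((twoRow_mem_arrays b hb ha).1 hL i).trans (ha i).symm)
    refine ⟨π, ⟨hπ, fun x hx => ?_⟩, rfl⟩
    exact hf (b x) (mem_univ _) ((hasFix_twoRow_perm_iff hπ _).2 ⟨x, rfl, hx⟩)

end Encoding

/-! ### Specialisation to consecutive blocks. -/

section Blocks

variable {k : ℕ} (a : Fin k → ℕ)

/-- The index of the block that contains a given point. -/
def blockOf (x : Fin (∑ j, a j)) : Fin k := (finSigmaFinEquiv.symm x).1

theorem blockOf_bounds (x : Fin (∑ j, a j)) :
    ∑ j ∈ Iio (blockOf a x), a j ≤ (x : ℕ) ∧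
      (x : ℕ) < ∑ j ∈ Iio (blockOf a x), a j + a (blockOf a x) := by
  obtain ⟨⟨i, r⟩, rfl⟩ := finSigmaFinEquiv.surjective x
  have hsum : ∑ l : Fin i, a (Fin.castLE i.2.le l) = ∑ j ∈ Iio i, a j := by
    refine sum_nbij (fun l => Fin.castLE i.2.le l) ?_ ?_ ?_ fun l _ => rfl
    · exact fun l _ => mem_Iio.2 l.2
    · exact (Fin.castLE_injective _).injOn
    · exact fun j hj => ⟨⟨j, (mem_Iio.1 (mem_coe.1 hj) : j < i)⟩, mem_univ _, rfl⟩
  simp only [blockOf, Equiv.symm_apply_apply, finSigmaFinEquiv_apply, hsum]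
  exact ⟨Nat.le_add_right _ _, by have := r.2; omega⟩

theorem sum_Iio_add_le {i j : Fin k} (h : i < j) :
    ∑ l ∈ Iio i, a l + a i ≤ ∑ l ∈ Iio j, a l := by
  rw [add_comm, ← sum_insert (by simp : i ∉ Iio i)]
  refine sum_le_sum_of_subset fun l hl => ?_
  rcases mem_insert.1 hl with rfl | hl
  · exact mem_Iio.2 h
  · exact mem_Iio.2 ((mem_Iio.1 hl).trans h)

theorem mem_block_iff {x : Fin (∑ j, a j)} {i : Fin k} : x ∈ block a i ↔ blockOf a x = i := by
  have h := blockOf_bounds a x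
  simp only [block, mem_filter, mem_univ, true_and]
  constructor
  · rintro ⟨h1, h2⟩
    rcases lt_trichotomy (blockOf a x) i with hlt | heq | hlt
    · have := sum_Iio_add_le a hlt; omega
    · exact heq
    · have := sum_Iio_add_le a hlt; omega
  · rintro rfl
    exact h

theorem blockOf_monotone : Monotone (blockOf a) := by
  intro x y hxy
  by_contra! hlt
  have h1 := blockOf_bounds a x
  have h2 := blockOf_bounds a y
  have h3 := sum_Iio_add_le a hlt
  have : (x : ℕ) ≤ y := hxy
  omega

theorem card_blockOf_eq (i : Fin k) : #{x | blockOf a x = i} = a i := by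
  rw [← Fintype.card_subtype]
  have e : {x // blockOf a x = i} ≃ Fin (a i) :=
    (finSigmaFinEquiv.symm.subtypeEquiv (q := fun p => p.1 = i) fun x => Iff.rfl).trans
      (Equiv.sigmaSubtype i)
  rw [Fintype.card_congr e, Fintype.card_fin]

theorem ncard_arrays : ((arrays a).ncard : ℚ) =
    ((∑ j, a j).factorial : ℚ) / ∏ i, ((a i).factorial : ℚ) := by
  rw [eq_div_iff (prod_ne_zero_iff.2 fun i _ => by positivity),
    ← ncard_arrays_mul (blockOf a) (blockOf_monotone a) (card_blockOf_eq a)]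
  push_cast
  rfl

theorem isASPerm_iff (S : Finset (Fin k)) (π : Equiv.Perm (Fin (∑ j, a j))) :
    IsASPerm a S π ↔ MonotoneOnFibers (blockOf a) S π := by
  simp only [IsASPerm, StrictAntiOn, StrictMonoOn, mem_coe, mem_block_iff, MonotoneOnFibers]
  constructor
  · rintro ⟨h1, h2⟩ x y hxy hlt
    split_ifs with hx
    · exact h1 _ hx rfl hxy.symm hlt
    · exact h2 _ hx rfl hxy.symm hlt
  · intro h
    constructor
    · rintro i hi x rfl y hy hlt
      simpa [hi] using h x y hy.symm hlt
    · rintro i hi x rfl y hy hlt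
      simpa [hi] using h x y hy.symm hlt

theorem ncard_asDerangements (S : Finset (Fin k)) :
    (asDerangements a S).ncard = (fixFreeArrays S univ a).ncard := by
  rw [← ncard_derangements_eq (blockOf_monotone a) S (card_blockOf_eq a)]
  simp only [asDerangements, isASPerm_iff]

theorem subset_block_iff {C : Finset (Fin (∑ j, a j))} {i : Fin k} :
    C ⊆ block a i ↔ ∀ x ∈ C, blockOf a x = i := by
  simp only [subset_iff, mem_block_iff]

/-- The factor 1 + ε(C) is 2 for even cycles in descending blocks and 0 for all other small cycles.
-/
theorem weight_eq_prod (S : Finset (Fin k)) (π : Equiv.Perm (Fin (∑ j, a j))) :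
    (weight a S π : ℤ) = ∏ C ∈ orbitFinsets π with ∃ i, ∀ x ∈ C, blockOf a x = i,
      (1 + cycleSign (blockOf a) S C) := by
  have hsmall : smallCycles a π =
      (orbitFinsets π).filter fun C => ∃ i, ∀ x ∈ C, blockOf a x = i := by
    simp only [smallCycles, subset_block_iff]
    rfl
  rw [← hsmall]
  have hmem : ∀ C ∈ smallCycles a π, C ∈ orbitFinsets π := fun C hC =>
    (mem_filter.1 (hsmall ▸ hC)).1
  unfold weight
  split_ifs with h
  · rcases h with ⟨C, hC, hodd⟩ | ⟨C, hC, i, hi, hCi⟩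
    · refine (prod_eq_zero hC ?_).symm
      unfold cycleSign
      split_ifs <;> simp [hodd.neg_one_pow]
    · refine (prod_eq_zero hC ?_).symm
      rw [subset_block_iff] at hCi
      rw [cycleSign, if_pos fun x hx => by rw [hCi x hx]; exact hi]
      rfl
  · push Not at h
    rw [prod_congr rfl fun C hC => ?_, prod_const]
    · push_cast
      rfl
    · obtain ⟨x, hx⟩ := exists_mem_of_mem_orbitFinsets (hmem C hC)
      obtain ⟨i, hi⟩ := (mem_filter.1 hC).2
      have hiS : i ∈ S := by
        by_contra hiS
        exact h.2 C hC i hiS hi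
      rw [cycleSign, if_neg fun hall => hall x hx (by rwa [(subset_block_iff a).1 hi x hx]),
        (Nat.not_odd_iff_even.1 (h.1 C hC)).neg_one_pow]
      rfl

end Blocks

end BlockDerangement

theorem theorem5p1 {k : ℕ} (a : Fin k → ℕ) (S : Finset (Fin k)) :
    ((BlockDerangement.asDerangements a S).ncard : ℚ) =
      1 / (∏ i, (Nat.factorial (a i) : ℚ)) *
        ∑ π : Equiv.Perm (Fin (∑ j, a j)), (BlockDerangement.weight a S π : ℚ) := by
  open BlockDerangement Finset in
  have hl : ((asDerangements a S).ncard : ℚ) =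
      ∑ u ∈ Fintype.piFinset fun i => removals S i (a i),
        (-1) ^ (∑ i, u i) * ((arrays (a - u)).ncard : ℚ) := by
    have := ncard_fixFreeArrays_eq_sum S univ a
    simp only [mem_univ, if_true] at this
    rw [ncard_asDerangements]
    exact_mod_cast this
  have hr : (∑ π : Equiv.Perm (Fin (∑ j, a j)), (weight a S π : ℚ)) =
      ∑ u ∈ Fintype.piFinset fun i => range (a i + 1),
        ((∏ i, (a i).choose (u i) : ℕ) : ℚ) * ((-1) ^ (∑ i, u i) *
          if ∀ i ∉ S, u i ≤ 1 then
            ((((∑ j, a j) - ∑ i, u i).factorial * ∏ i, (u i).factorial : ℕ) : ℚ) else 0) := by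
    have := sum_prod_one_add_cycleSign (blockOf a) S
    simp only [card_blockOf_eq, Fintype.card_fin, ← weight_eq_prod] at this
    exact_mod_cast congrArg (Int.cast : ℤ → ℚ) this
  rw [hl, hr, mul_sum]
  have hset : (Fintype.piFinset fun i => removals S i (a i)) =
      (Fintype.piFinset fun i => range (a i + 1)).filter fun u => ∀ i ∉ S, u i ≤ 1 := by
    ext u
    simp only [Fintype.mem_piFinset, removals, mem_filter, forall_and]
  rw [hset, sum_filter]
  refine sum_congr rfl fun u hu => ?_
  split_ifs
  · have hle : ∀ i, u i ≤ a i := fun i =>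
      Nat.lt_succ_iff.1 (mem_range.1 (Fintype.mem_piFinset.1 hu i))
    have hsub : ∑ j, (a - u) j = ∑ j, a j - ∑ j, u j := sum_tsub_distrib _ fun i _ => hle i
    -- By a_i! = C(a_i, u_i) u_i! (a_i - u_i)!, dividing the term of u on the weight side by ∏ a_i!
    -- leaves the multinomial coefficient of a - u.
    have hch : (∏ i, ((a i).factorial : ℚ)) =
        (∏ i, ((a i).choose (u i) : ℚ)) * (∏ i, ((u i).factorial : ℚ)) *
          ∏ i, (((a - u) i).factorial : ℚ) := by
      rw [← prod_mul_distrib, ← prod_mul_distrib]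
      refine prod_congr rfl fun i _ => ?_
      exact_mod_cast (Nat.choose_mul_factorial_mul_factorial (hle i)).symm
    have h1 : (∏ i, ((a i).choose (u i) : ℚ)) ≠ 0 :=
      prod_ne_zero_iff.2 fun i _ => by exact_mod_cast (Nat.choose_pos (hle i)).ne'
    have h2 : (∏ i, ((u i).factorial : ℚ)) ≠ 0 := prod_ne_zero_iff.2 fun i _ => by positivity
    have h3 : (∏ i, (((a - u) i).factorial : ℚ)) ≠ 0 :=
      prod_ne_zero_iff.2 fun i _ => by positivity
    rw [ncard_arrays, hsub, hch]
    push_cast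
    field_simp
  · simp
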